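/- Let $T\ge 1$, $N\ge 0$, $m\ge 0$ be integers, let $\omega\in\mathbb C$ be a primitive $T$-th root of unity, and let $z_1,\dots,z_N\in\mathbb C$ be non-zero numbers whose orbits $\{\omega^k z_j : 0\le k<T\}$ are pairwise disjoint. Let $\mathcal C_{0,N;m}$ be the (cyclotomic discriminantal) arrangement of affine hyperplanes in $\mathbb C^m$, with coordinates $t_1,\dots,t_m$, consisting of $$t_i-\omega^k t_j=0\ (1\le i<j\le m),\qquad t_i-\omega^k z_j=0\ (1\le i\le m,\ 1\le j\le N),\qquad t_i=0\ (1\le i\le m),$$ where $k\in\{0,\dots,T-1\}$. For a finite arrangement $\mathcal C$ of affine hyperplanes in $\mathbb C^m$, an *edge* is a non-empty intersection of hyperplanes of $\mathcal C$ (the empty intersection $\mathbb C^m$ included). For $p\ge 0$ let $\mathrm{Flag}^p(\mathcal C)$ be the set of chains $\mathbb C^m=L^0\supset L^1\supset\dots\supset L^p$ of edges with $\operatorname{codim}L^j=j$, and let $\mathscr F^p(\mathcal C,\mathbb Z)$ be the quotient of the free abelian group on $\mathrm{Flag}^p(\mathcal C)$ by the relations $$\sum_{F\supset\widehat F}F=0,$$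 one for every $0<i<p$ and every chain of edges $\widehat F=(L^0\supset\dots\supset L^{i-1}\supset L^{i+1}\supset\dots\supset L^p)$ with $\operatorname{codim}L^j=j$, where the sum is over all $F\in\mathrm{Flag}^p(\mathcal C)$ that agree with $\widehat F$ in all positions $j\ne i$. Put $\mathscr F^p(\mathcal C)=\mathscr F^p(\mathcal C,\mathbb Z)\otimes_{\mathbb Z}\mathbb C$. Then $$\sum_{p=0}^m x^p\dim_{\mathbb C}\mathscr F^p(\mathcal C_{0,N;m})=\prod_{p=0}^{m-1}\Bigl(1+\bigl(1+(p+N)T\bigr)x\Bigr).$$ -/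

import Mathlib

open scoped TensorProduct Polynomial

/-- The affine hyperplane `{v | f v = c}` of `ℂ^m`, for a linear form `f` and a constant `c`
(it is a hyperplane when `f ≠ 0`). -/
def affineHyperplane {m : ℕ} (f : (Fin m → ℂ) →ₗ[ℂ] ℂ) (c : ℂ) :
    AffineSubspace ℂ (Fin m → ℂ) where
  carrier := {v | f v = c}
  smul_vsub_vadd_mem' := by
    intro a p q r hp hq hr
    simp only [Set.mem_ofPred_eq] at hp hq hr ⊢
    simp [hp, hq, hr]

/-- An arrangement in `ℂ^m`: a finite collection of affine hyperplanes. -/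
structure Arrangement (m : ℕ) where
  hyperplanes : Set (AffineSubspace ℂ (Fin m → ℂ))
  finite : hyperplanes.Finite
  isHyperplane : ∀ H ∈ hyperplanes,
    ∃ (f : (Fin m → ℂ) →ₗ[ℂ] ℂ) (c : ℂ), f ≠ 0 ∧ H = affineHyperplane f c

/-- The codimension of an affine subspace `L` of `ℂ^m` (used for non-empty `L`). -/
noncomputable def affineCodim {m : ℕ} (L : AffineSubspace ℂ (Fin m → ℂ)) : ℕ :=
  Module.finrank ℂ ((Fin m → ℂ) ⧸ L.direction)

namespace Arrangement

variable {m : ℕ}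

/-- An edge: a non-empty intersection of hyperplanes of the arrangement.
The empty intersection, `ℂ^m` itself, is an edge. -/
def IsEdge (A : Arrangement m) (L : AffineSubspace ℂ (Fin m → ℂ)) : Prop :=
  (L : Set (Fin m → ℂ)).Nonempty ∧ ∃ S ⊆ A.hyperplanes, L = sInf S

/-- Flags `ℂ^m = L^0 ⊃ L^1 ⊃ ⋯ ⊃ L^k` of edges of `A`, with `L^j` of codimension `j`. -/
@[ext]
structure Flag (A : Arrangement m) (k : ℕ) where
  edge : Fin (k + 1) → AffineSubspace ℂ (Fin m → ℂ)
  isEdge : ∀ j, A.IsEdge (edge j)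
  codim_eq : ∀ j, affineCodim (edge j) = j
  antitone : Antitone edge

/-- `L` is a flag of length `k` with a gap at position `i`:
`L^0 ⊃ ⋯ ⊃ L^{i-1} ⊃ L^{i+1} ⊃ ⋯ ⊃ L^k`. The value `L i` is irrelevant. -/
structure IsFlagWithGap (A : Arrangement m) {k : ℕ} (i : Fin (k + 1))
    (L : Fin (k + 1) → AffineSubspace ℂ (Fin m → ℂ)) : Prop where
  isEdge : ∀ j, j ≠ i → A.IsEdge (L j)
  codim_eq : ∀ j, j ≠ i → affineCodim (L j) = j
  antitone : ∀ j l, j ≠ i → l ≠ i → j ≤ l → L l ≤ L j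

instance finite_flag (A : Arrangement m) (k : ℕ) : Finite (A.Flag k) := by
  have h : {L | A.IsEdge L}.Finite := by
    refine (A.finite.finite_subsets.image sInf).subset ?_
    rintro L ⟨-, S, hS, rfl⟩
    exact ⟨S, hS, rfl⟩
  have : Finite {L | A.IsEdge L} := h
  refine Finite.of_injective
    (fun (F : A.Flag k) (j : Fin (k + 1)) => (⟨F.edge j, F.isEdge j⟩ : {L | A.IsEdge L})) ?_
  intro F G hFG
  ext1
  funext j
  exact congrArg Subtype.val (congrFun hFG j)

noncomputable instance fintypeFlag (A : Arrangement m) (k : ℕ) : Fintype (A.Flag k) :=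
  Fintype.ofFinite _

open Classical in
/-- The sum, in the free abelian group on the flags, of all flags that agree with `L` away
from position `i`. -/
noncomputable def gapSum (A : Arrangement m) {k : ℕ} (i : Fin (k + 1))
    (L : Fin (k + 1) → AffineSubspace ℂ (Fin m → ℂ)) : A.Flag k →₀ ℤ :=
  ∑ F : A.Flag k with ∀ j, j ≠ i → F.edge j = L j, Finsupp.single F 1

/-- The subgroup of flag relations: it is generated by the sums `∑_{F ⊃ F̂} F`, for all flags `F̂`
with a gap at some position `0 < i < k`. -/
noncomputable def flagRelations (A : Arrangement m) (k : ℕ) : Submodule ℤ (A.Flag k →₀ ℤ) :=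
  Submodule.span ℤ
    {r | ∃ (i : Fin (k + 1)) (L : Fin (k + 1) → AffineSubspace ℂ (Fin m → ℂ)),
      0 < i ∧ i < Fin.last k ∧ A.IsFlagWithGap i L ∧ r = A.gapSum i L}

/-- The flag group `F^k(A, ℤ)`: the free abelian group on the flags modulo the flag relations. -/
abbrev FlagGroup (A : Arrangement m) (k : ℕ) : Type :=
  (A.Flag k →₀ ℤ) ⧸ A.flagRelations k

/-- The flag space `F^k(A) = F^k(A, ℤ) ⊗ ℂ`. -/
abbrev FlagSpace (A : Arrangement m) (k : ℕ) : Type :=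
  ℂ ⊗[ℤ] A.FlagGroup k

/-- The Poincaré polynomial `∑_{p=0}^m x^p dim F^p(A)`. -/
noncomputable def poincarePolynomial (A : Arrangement m) : ℕ[X] :=
  ∑ p ∈ Finset.range (m + 1),
    Polynomial.C (Module.finrank ℂ (A.FlagSpace p)) * Polynomial.X ^ p

end Arrangement

/-- The hyperplane `t_i - ω^k t_j = 0`. -/
noncomputable def hyperplaneT {m : ℕ} (ω : ℂ) (i j : Fin m) (k : ℕ) :
    AffineSubspace ℂ (Fin m → ℂ) :=
  affineHyperplane (LinearMap.proj i - ω ^ k • LinearMap.proj j) 0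

/-- The hyperplane `t_i = a`. -/
noncomputable def hyperplaneC {m : ℕ} (i : Fin m) (a : ℂ) : AffineSubspace ℂ (Fin m → ℂ) :=
  affineHyperplane (LinearMap.proj i) a

/-- The arrangement `C_{0,N;m}`: the hyperplanes `t_i - ω^k t_j = 0` (`i < j`),
`t_i - ω^k z_j = 0` and `t_i = 0`, where `k` runs through `{0, …, T - 1}`. -/
noncomputable def cyclotomicArrangement (m N T : ℕ) (ω : ℂ) (z : Fin N → ℂ) : Arrangement m where
  hyperplanes :=
    {H | ∃ (i j : Fin m) (k : Fin T), i < j ∧ H = hyperplaneT ω i j k} ∪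
    {H | ∃ (i : Fin m) (j : Fin N) (k : Fin T), H = hyperplaneC i (ω ^ (k : ℕ) * z j)} ∪
    {H | ∃ i : Fin m, H = hyperplaneC i 0}
  finite := by
    refine Set.Finite.union (Set.Finite.union ?_ ?_) ?_
    · refine (Set.finite_range
        (fun x : Fin m × Fin m × Fin T => hyperplaneT ω x.1 x.2.1 x.2.2)).subset ?_
      rintro H ⟨i, j, k, -, rfl⟩
      exact ⟨(i, j, k), rfl⟩
    · refine (Set.finite_range
        (fun x : Fin m × Fin N × Fin T =>
          hyperplaneC x.1 (ω ^ (x.2.2 : ℕ) * z x.2.1))).subset ?_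
      rintro H ⟨i, j, k, rfl⟩
      exact ⟨(i, j, k), rfl⟩
    · refine (Set.finite_range (fun i : Fin m => hyperplaneC i 0)).subset ?_
      rintro H ⟨i, rfl⟩
      exact ⟨i, rfl⟩
  isHyperplane := by
    have hproj : ∀ i : Fin m, (LinearMap.proj i : (Fin m → ℂ) →ₗ[ℂ] ℂ) ≠ 0 := by
      intro i h
      have := LinearMap.congr_fun h (Pi.single i 1)
      simp at this
    rintro H ((⟨i, j, k, hij, rfl⟩ | ⟨i, j, k, rfl⟩) | ⟨i, rfl⟩)
    · refine ⟨_, _, ?_, rfl⟩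
      intro h
      have := LinearMap.congr_fun h (Pi.single i 1)
      simp [hij.ne'] at this
    · exact ⟨_, _, hproj i, rfl⟩
    · exact ⟨_, _, hproj i, rfl⟩

/-! The arrangement is fibre-type (supersolvable). The level of a hyperplane is the last coordinate
occurring in its equation. Solved for that coordinate, the equation is t_i = s with s one of 0, ω^k
z_j, or ω^k t_j for j < i. With i counted from 0, this makes 1 + (i + N)T hyperplanes of level i.
Two distinct ones of the same level that meet do so over the locus s = s', which is again a
hyperplane of the arrangement, of lower level.

This modularity, `IsFibration`, determines the dimensions. An edge is cut out by one hyperplane for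
each level occurring among those that contain it, however chosen (`le_edge_of_pivots`), so its
codimension is the number of these levels, and each step of a flag adds exactly one level, its
label. The flags with decreasing labels form a basis. They span because the relation at an ascent
replaces a flag by flags with a descent there (`exists_weight_lt`). They are independent because
alternating sums over reorderings of a sequence of hyperplanes kill the relations
(`alternatingCoord_gapSum`) and form a dual family (`flagGroupCoord_flagClass`). Such flags amount
to a set of p levels and a hyperplane in each, so dim F^p is the p-th elementary symmetric function
of the level sizes and the generating polynomial factors. -/

/-! ### Pivots and transversality -/

/-- `H` is the hyperplane of an affine form whose last non-zero coefficient is the `i`-th one. -/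
def HasPivot {m : ℕ} (H : AffineSubspace ℂ (Fin m → ℂ)) (i : Fin m) : Prop :=
  ∃ (f : (Fin m → ℂ) →ₗ[ℂ] ℂ) (c : ℂ), H = affineHyperplane f c ∧
    f (Pi.single i 1) ≠ 0 ∧ ∀ j, i < j → f (Pi.single j 1) = 0

theorem mem_affineHyperplane {m : ℕ} {f : (Fin m → ℂ) →ₗ[ℂ] ℂ} {c : ℂ} {v : Fin m → ℂ} :
    v ∈ affineHyperplane f c ↔ f v = c := Iff.rfl

/-- Triangular systems of affine equations are solvable. -/
theorem exists_forall_eq_of_pivot {m : ℕ} {ι : Type*} (f : ι → (Fin m → ℂ) →ₗ[ℂ] ℂ)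
    {q : ι → Fin m} (hq : Function.Injective q) (h₁ : ∀ j, f j (Pi.single (q j) 1) ≠ 0)
    (h₂ : ∀ j l, q j < l → f j (Pi.single l 1) = 0) (c : ι → ℂ) :
    ∃ v, ∀ j, f j v = c j := by
  -- The equations are solved in the order of their pivots: moving along coordinate `n` settles the
  -- only equation with that pivot, and those with smaller pivots do not involve it.
  have key : ∀ n : ℕ, ∃ v, ∀ j, (q j : ℕ) < n → f j v = c j := by
    intro n
    induction n with
    | zero => exact ⟨0, fun j hj => absurd hj (Nat.not_lt_zero _)⟩
    | succ n ih =>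
      obtain ⟨v, hv⟩ := ih
      by_cases h : ∃ j₀, (q j₀ : ℕ) = n
      · obtain ⟨j₀, hj₀⟩ := h
        refine ⟨v + ((c j₀ - f j₀ v) / f j₀ (Pi.single (q j₀) 1)) • Pi.single (q j₀) 1, ?_⟩
        intro j hj
        rcases (Nat.lt_succ_iff_lt_or_eq.1 hj) with hlt | heq
        · rw [map_add, map_smul, h₂ j (q j₀) (by rw [Fin.lt_def]; omega), hv j hlt]
          simp
        · have : j = j₀ := hq (Fin.ext (heq.trans hj₀.symm))
          subst this
          rw [map_add, map_smul, smul_eq_mul, div_mul_cancel₀ _ (h₁ j)]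
          ring
      · refine ⟨v, fun j hj => hv j ?_⟩
        have : (q j : ℕ) ≠ n := fun e => h ⟨j, e⟩
        omega
  obtain ⟨v, hv⟩ := key m
  exact ⟨v, fun j => hv j (q j).2⟩

/-- Hyperplanes with distinct pivots intersect transversally. -/
theorem iInf_of_injective_pivot {m : ℕ} {ι : Type*} [Fintype ι]
    (H : ι → AffineSubspace ℂ (Fin m → ℂ)) {q : ι → Fin m} (hq : Function.Injective q)
    (hH : ∀ j, HasPivot (H j) (q j)) :
    ((⨅ j, H j : AffineSubspace ℂ (Fin m → ℂ)) : Set (Fin m → ℂ)).Nonempty ∧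
      affineCodim (⨅ j, H j) = Fintype.card ι := by
  choose f c hf h₁ h₂ using hH
  obtain ⟨v, hv⟩ := exists_forall_eq_of_pivot f hq h₁ h₂ c
  have hmem : ∀ w, w ∈ (⨅ j, H j) ↔ ∀ j, f j w = c j := by
    intro w
    rw [AffineSubspace.mem_iInf_iff]
    exact forall_congr' fun j => by rw [hf j, mem_affineHyperplane]
  refine ⟨⟨v, (hmem v).2 hv⟩, ?_⟩
  have hL : (⨅ j, H j) = AffineSubspace.mk' v (LinearMap.ker (LinearMap.pi f)) := by
    ext w
    rw [hmem, AffineSubspace.mem_mk', LinearMap.mem_ker, funext_iff]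
    refine forall_congr' fun j => ?_
    simp [hv j, sub_eq_zero]
  have hsurj : Function.Surjective (LinearMap.pi f) := fun c' => by
    obtain ⟨w, hw⟩ := exists_forall_eq_of_pivot f hq h₁ h₂ c'
    exact ⟨w, funext hw⟩
  rw [affineCodim, hL, AffineSubspace.direction_mk',
    (LinearMap.quotKerEquivOfSurjective _ hsurj).finrank_eq, Module.finrank_fintype_fun_eq_card]

theorem AffineSubspace.eq_of_le_of_affineCodim_eq {m : ℕ} {L M : AffineSubspace ℂ (Fin m → ℂ)}
    (h : L ≤ M) (hL : (L : Set (Fin m → ℂ)).Nonempty) (hc : affineCodim L = affineCodim M) :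
    L = M := by
  refine AffineSubspace.eq_of_direction_eq_of_nonempty_of_le ?_ hL h
  refine Submodule.eq_of_le_of_finrank_eq (AffineSubspace.direction_le h) ?_
  have h₁ := Submodule.finrank_quotient_add_finrank L.direction
  have h₂ := Submodule.finrank_quotient_add_finrank M.direction
  rw [affineCodim, affineCodim] at hc
  omega

/-! ### Fibrations: edges and the levels around them -/

namespace Arrangement

variable {m : ℕ} {A : Arrangement m}

/-- A fibration of `A`: every hyperplane is assigned its pivot, and any two hyperplanes with the
same pivot which meet span a pencil containing a hyperplane with a smaller pivot. -/
structure IsFibration (A : Arrangement m) (level : A.hyperplanes → Fin m) : Prop where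
  hasPivot : ∀ H, HasPivot H.1 (level H)
  modular : ∀ H K, level H = level K → H ≠ K → ∀ v ∈ H.1, v ∈ K.1 →
    ∃ M, level M < level H ∧ H.1 ⊓ K.1 ≤ M.1 ∧ M.1 ⊓ H.1 ≤ K.1

open Classical in
/-- The levels of the hyperplanes containing `L`. -/
noncomputable def pivots (level : A.hyperplanes → Fin m) (L : AffineSubspace ℂ (Fin m → ℂ)) :
    Finset (Fin m) :=
  {i | ∃ H, level H = i ∧ L ≤ H.1}

theorem mem_pivots {level : A.hyperplanes → Fin m} {L : AffineSubspace ℂ (Fin m → ℂ)}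
    {i : Fin m} : i ∈ pivots level L ↔ ∃ H, level H = i ∧ L ≤ H.1 := by
  simp [pivots]

theorem pivots_anti {level : A.hyperplanes → Fin m} {L M : AffineSubspace ℂ (Fin m → ℂ)}
    (h : L ≤ M) : pivots level M ⊆ pivots level L := by
  intro i hi
  obtain ⟨H, h₁, h₂⟩ := mem_pivots.1 hi
  exact mem_pivots.2 ⟨H, h₁, h.trans h₂⟩

namespace IsFibration

variable {level : A.hyperplanes → Fin m} (hA : A.IsFibration level)
include hA

/-- Induction on the level of `H`. If the given common hyperplane `K` of that level is not `H`,
modularity yields a lower hyperplane through `H ∩ K`, hence through `M`. By induction it contains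
`L`, and together with `K` it cuts out a subset of `H`. The cutoff `a` lets levels above it be
ignored. -/
theorem le_of_pivots {L M : AffineSubspace ℂ (Fin m → ℂ)}
    (hM : (M : Set (Fin m → ℂ)).Nonempty) (a : Fin m)
    (h : ∀ i ≤ a, i ∈ pivots level M → ∃ H, level H = i ∧ M ≤ H.1 ∧ L ≤ H.1)
    (H : A.hyperplanes) (hHa : level H ≤ a) (hMH : M ≤ H.1) : L ≤ H.1 := by
  obtain ⟨v, hv⟩ := hM
  induction hi : level H using WellFoundedLT.induction generalizing H with
  | ind i ih =>
    subst hi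
    obtain ⟨K, hK, hMK, hLK⟩ := h _ hHa (mem_pivots.2 ⟨H, rfl, hMH⟩)
    by_cases hne : K = H
    · exact hne ▸ hLK
    obtain ⟨N, hN, h₁, h₂⟩ := hA.modular K H hK hne v (hMK hv) (hMH hv)
    have hLN : L ≤ N.1 := ih (level N) (hK ▸ hN) N ((hK ▸ hN).le.trans hHa)
      ((le_inf hMK hMH).trans h₁) rfl
    exact (le_inf hLN hLK).trans h₂

theorem le_edge_of_pivots {L K : AffineSubspace ℂ (Fin m → ℂ)} (hK : A.IsEdge K)
    (h : ∀ i ∈ pivots level K, ∃ H, level H = i ∧ K ≤ H.1 ∧ L ≤ H.1) : L ≤ K := by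
  obtain ⟨hne, S, hS, rfl⟩ := hK
  refine le_sInf fun H hH => ?_
  exact hA.le_of_pivots hne (level ⟨H, hS hH⟩) (fun i _ hi => h i hi) ⟨H, hS hH⟩ le_rfl
    (sInf_le hH)

/-- One hyperplane per pivot already cuts out `L`, and distinct pivots make these transversal. -/
theorem affineCodim_eq_card_pivots {L : AffineSubspace ℂ (Fin m → ℂ)} (hL : A.IsEdge L) :
    affineCodim L = (pivots level L).card := by
  have h : ∀ i : pivots level L, ∃ H, level H = i ∧ L ≤ H.1 := fun i => mem_pivots.1 i.2
  choose H hH hLH using h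
  have hLe : L = ⨅ i, (H i).1 := by
    refine le_antisymm (le_iInf hLH) (hA.le_edge_of_pivots hL fun i hi => ?_)
    exact ⟨H ⟨i, hi⟩, hH _, hLH _, iInf_le _ _⟩
  have := (iInf_of_injective_pivot (fun i => (H i).1) (q := fun i => (i : Fin m))
    Subtype.val_injective fun i => hH i ▸ hA.hasPivot (H i)).2
  rw [← hLe] at this
  rw [this, Fintype.card_coe]

end IsFibration
end Arrangement

/-! ### Flags of sequences of hyperplanes, and their linear independence -/

namespace Arrangement

variable {m : ℕ} {A : Arrangement m}

namespace IsFibration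

variable {level : A.hyperplanes → Fin m} (hA : A.IsFibration level) {p : ℕ}
include hA

/-- The flag of intersections of the initial segments of a sequence of hyperplanes whose levels
are distinct. -/
noncomputable def flagOfSeq (T : Fin p → A.hyperplanes)
    (hT : Function.Injective fun j => level (T j)) : A.Flag p where
  edge k := ⨅ j : {j : Fin p // j.castSucc < k}, (T j).1
  isEdge k := by
    refine ⟨(iInf_of_injective_pivot _ (hT.comp Subtype.val_injective)
      fun j => hA.hasPivot (T j)).1, _, ?_, rfl⟩
    rintro _ ⟨j, rfl⟩
    exact (T j).2
  codim_eq k := by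
    rw [(iInf_of_injective_pivot _ (hT.comp Subtype.val_injective)
      fun j => hA.hasPivot (T j)).2, Fintype.card_subtype]
    rw [← Finset.card_map Fin.castSuccEmb]
    have : Finset.map Fin.castSuccEmb ({j : Fin p | j.castSucc < k} : Finset (Fin p)) =
        Finset.Iio k := by
      ext l
      simp only [Finset.mem_map, Finset.mem_filter, Finset.mem_univ, true_and, Finset.mem_Iio]
      constructor
      · rintro ⟨j, hj, rfl⟩
        exact hj
      · intro hl
        exact ⟨l.castPred (ne_of_lt (hl.trans_le (Fin.le_last k))), by simpa using hl, by simp⟩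
    rw [this, Fin.card_Iio]
  antitone k l hkl := le_iInf fun j => iInf_le
    (fun j : {j : Fin p // j.castSucc < l} => (T j).1) ⟨j.1, j.2.trans_le hkl⟩

theorem flagOfSeq_edge_le (T : Fin p → A.hyperplanes)
    (hT : Function.Injective fun j => level (T j)) {j : Fin p} {k : Fin (p + 1)}
    (h : j.castSucc < k) : (hA.flagOfSeq T hT).edge k ≤ (T j).1 :=
  iInf_le (fun j : {j : Fin p // j.castSucc < k} => (T j).1) ⟨j, h⟩

theorem card_pivots_edge (F : A.Flag p) (k : Fin (p + 1)) :
    (pivots level (F.edge k)).card = k := by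
  rw [← hA.affineCodim_eq_card_pivots (F.isEdge k), F.codim_eq]

/-- The levels of the first `k` hyperplanes are clearly pivots. There are no others, since the
number of pivots is the codimension. -/
theorem mem_pivots_flagOfSeq (T : Fin p → A.hyperplanes)
    (hT : Function.Injective fun j => level (T j)) (k : Fin (p + 1)) (i : Fin m) :
    i ∈ pivots level ((hA.flagOfSeq T hT).edge k) ↔ ∃ j, j.castSucc < k ∧ level (T j) = i := by
  have hs : Finset.univ.image (fun j : {j : Fin p // j.castSucc < k} => level (T j)) =
      pivots level ((hA.flagOfSeq T hT).edge k) := by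
    refine Finset.eq_of_subset_of_card_le ?_ ?_
    · intro i hi
      obtain ⟨j, -, rfl⟩ := Finset.mem_image.1 hi
      exact mem_pivots.2 ⟨T j, rfl, hA.flagOfSeq_edge_le T hT j.2⟩
    · rw [Finset.card_image_of_injective Finset.univ
          (show Function.Injective fun j : {j : Fin p // j.castSucc < k} => level (T j) from
            hT.comp Subtype.val_injective),
        ← hA.affineCodim_eq_card_pivots ((hA.flagOfSeq T hT).isEdge k)]
      exact (iInf_of_injective_pivot _ (hT.comp Subtype.val_injective)
        fun j => hA.hasPivot (T j)).2.le
  rw [← hs]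
  simp [and_comm]

theorem eq_flagOfSeq {F : A.Flag p} {T : Fin p → A.hyperplanes}
    (hT : Function.Injective fun j => level (T j)) (h : ∀ j, F.edge j.succ ≤ (T j).1) :
    F = hA.flagOfSeq T hT := by
  ext1
  funext k
  refine AffineSubspace.eq_of_le_of_affineCodim_eq (le_iInf fun j => ?_) (F.isEdge k).1 ?_
  · exact (F.antitone (Fin.castSucc_lt_iff_succ_le.1 j.2)).trans (h j)
  · rw [F.codim_eq, (hA.flagOfSeq T hT).codim_eq]

/-- The level of the `k`-th hyperplane is the only pivot of the edge `k.succ` that is not one of the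
edge `k.castSucc`. -/
theorem level_eq_of_flagOfSeq_eq {T T' : Fin p → A.hyperplanes}
    {hT : Function.Injective fun j => level (T j)}
    {hT' : Function.Injective fun j => level (T' j)}
    (h : hA.flagOfSeq T hT = hA.flagOfSeq T' hT') (k : Fin p) : level (T k) = level (T' k) := by
  have h₁ := (hA.mem_pivots_flagOfSeq T hT k.succ (level (T k))).2 ⟨k, Fin.castSucc_lt_succ, rfl⟩
  rw [h, hA.mem_pivots_flagOfSeq] at h₁
  obtain ⟨j, hj, hjk⟩ := h₁
  rcases (Fin.castSucc_lt_succ_iff.1 hj).lt_or_eq with hlt | rfl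
  · have h₂ := (hA.mem_pivots_flagOfSeq T' hT' k.castSucc (level (T k))).2
      ⟨j, Fin.castSucc_lt_castSucc_iff.2 hlt, hjk⟩
    rw [← h, hA.mem_pivots_flagOfSeq] at h₂
    obtain ⟨l, hl, hlk⟩ := h₂
    have := hT hlk
    subst this
    exact absurd hl (lt_irrefl _)
  · exact hjk.symm

/-- Since the levels decrease, the level of `T k` is the lowest pivot of the edge `k.succ`, and
`le_of_pivots` allows only one hyperplane of that level around the edge. Distinct levels alone would
not suffice: t_1 = 0 followed by t_2 = 0 or by t_2 = t_1 gives the same flag. -/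
theorem eq_of_flagOfSeq_eq {T T' : Fin p → A.hyperplanes}
    (hT : StrictAnti fun j => level (T j)) (hT' : StrictAnti fun j => level (T' j))
    (h : hA.flagOfSeq T hT.injective = hA.flagOfSeq T' hT'.injective) : T = T' := by
  have key : ∀ {T T' : Fin p → A.hyperplanes}
      (hT : StrictAnti fun j => level (T j)) (hT' : StrictAnti fun j => level (T' j)),
      hA.flagOfSeq T hT.injective = hA.flagOfSeq T' hT'.injective →
      ∀ k, (T k).1 ≤ (T' k).1 := by
    intro T T' hT hT' h k
    refine hA.le_of_pivots ((hA.flagOfSeq T hT.injective).isEdge k.succ).1 (level (T k)) ?_ (T' k)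
      (hA.level_eq_of_flagOfSeq_eq h k).ge ?_
    · intro i hi hik
      obtain ⟨j, hj, rfl⟩ := (hA.mem_pivots_flagOfSeq _ _ _ _).1 hik
      have hjk : j = k := (Fin.castSucc_lt_succ_iff.1 hj).antisymm (hT.le_iff_ge.1 hi)
      subst hjk
      exact ⟨T j, rfl, hA.flagOfSeq_edge_le _ _ hj, le_rfl⟩
    · rw [h]
      exact hA.flagOfSeq_edge_le _ _ Fin.castSucc_lt_succ
  funext k
  exact Subtype.ext ((key hT hT' h k).antisymm (key hT' hT h.symm k))

theorem flagOfSeq_comp_perm_eq_iff {T T' : Fin p → A.hyperplanes}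
    (hT : StrictAnti fun j => level (T j)) (hT' : StrictAnti fun j => level (T' j))
    (σ : Equiv.Perm (Fin p)) :
    hA.flagOfSeq T hT.injective =
      hA.flagOfSeq (fun j => T' (σ j)) (hT'.injective.comp σ.injective) ↔ σ = 1 ∧ T = T' := by
  constructor
  · intro h
    have hσ : StrictMono σ := by
      intro j k hjk
      have := hT hjk
      simp only [hA.level_eq_of_flagOfSeq_eq h] at this
      exact hT'.lt_iff_gt.1 this
    -- The only order automorphism of a finite chain is the identity.
    have hσ1 : σ = 1 := by
      ext1 j
      exact DFunLike.congr_fun (Subsingleton.elim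
        (hσ.orderIsoOfSurjective _ σ.surjective) (OrderIso.refl _)) j
    subst hσ1
    exact ⟨rfl, hA.eq_of_flagOfSeq_eq hT hT' h⟩
  · rintro ⟨rfl, rfl⟩
    rfl

/-- The alternating sum of the coordinates of the flags obtained by reordering `T`. -/
noncomputable def alternatingCoord (T : Fin p → A.hyperplanes)
    (hT : Function.Injective fun j => level (T j)) : (A.Flag p →₀ ℤ) →ₗ[ℤ] ℤ :=
  ∑ σ : Equiv.Perm (Fin p), (Equiv.Perm.sign σ : ℤ) •
    Finsupp.lapply (hA.flagOfSeq (fun j => T (σ j)) (hT.comp σ.injective))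

open Classical in
theorem alternatingCoord_single (T : Fin p → A.hyperplanes)
    (hT : Function.Injective fun j => level (T j)) (F : A.Flag p) :
    hA.alternatingCoord T hT (Finsupp.single F 1) =
      ∑ σ : Equiv.Perm (Fin p), (Equiv.Perm.sign σ : ℤ) *
        if F = hA.flagOfSeq (fun j => T (σ j)) (hT.comp σ.injective) then 1 else 0 := by
  simp [alternatingCoord, LinearMap.sum_apply, Finsupp.single_apply]

/-- The `k`-th edge depends only on the set of the first `k` hyperplanes. Exchanging the neighbours
`a` and `b` alters that set only for the edge lying between them, of index `b.castSucc`. -/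
theorem flagOfSeq_comp_swap_edge_le (T : Fin p → A.hyperplanes)
    (hT : Function.Injective fun j => level (T j)) {a b : Fin p} (hab : (b : ℕ) = a + 1)
    {k : Fin (p + 1)} (hk : k ≠ b.castSucc) :
    (hA.flagOfSeq T hT).edge k ≤ (hA.flagOfSeq (fun j => T (Equiv.swap a b j))
      (hT.comp (Equiv.injective _))).edge k := by
  refine le_iInf fun j => hA.flagOfSeq_edge_le T hT ?_
  have hj := j.2
  have hk' : (k : ℕ) ≠ b := fun h => hk (Fin.ext h)
  rw [Fin.lt_def, Fin.val_castSucc] at hj ⊢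
  rw [Equiv.swap_apply_def]
  split_ifs with h₁ h₂
  · rw [h₁] at hj
    omega
  · rw [h₂] at hj
    omega
  · exact hj

theorem flagOfSeq_comp_swap_edge (T : Fin p → A.hyperplanes)
    (hT : Function.Injective fun j => level (T j)) {a b : Fin p} (hab : (b : ℕ) = a + 1)
    {k : Fin (p + 1)} (hk : k ≠ b.castSucc) :
    (hA.flagOfSeq (fun j => T (Equiv.swap a b j)) (hT.comp (Equiv.injective _))).edge k =
      (hA.flagOfSeq T hT).edge k := by
  refine le_antisymm ?_ (hA.flagOfSeq_comp_swap_edge_le T hT hab hk)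
  simpa using hA.flagOfSeq_comp_swap_edge_le (fun j => T (Equiv.swap a b j))
    (hT.comp (Equiv.injective _)) hab hk

/-- Sign-reversing involution: exchanging the two hyperplanes around position `i` changes only the
edge at the gap, so it preserves the condition of agreeing with `L` while flipping the sign. -/
theorem alternatingCoord_gapSum (T : Fin p → A.hyperplanes)
    (hT : Function.Injective fun j => level (T j)) {i : Fin (p + 1)} (h₀ : 0 < i)
    (h₁ : i < Fin.last p) (L : Fin (p + 1) → AffineSubspace ℂ (Fin m → ℂ)) :
    hA.alternatingCoord T hT (A.gapSum i L) = 0 := by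
  classical
  rw [Fin.lt_def] at h₀ h₁
  rw [Fin.val_zero] at h₀
  rw [Fin.val_last] at h₁
  obtain ⟨a, b, hab, hb⟩ : ∃ a b : Fin p, (b : ℕ) = a + 1 ∧ i = b.castSucc :=
    ⟨⟨i - 1, by omega⟩, ⟨i, h₁⟩, by simp only; omega, rfl⟩
  let G : Equiv.Perm (Fin p) → A.Flag p :=
    fun σ => hA.flagOfSeq (fun j => T (σ j)) (hT.comp σ.injective)
  have hsum : hA.alternatingCoord T hT (A.gapSum i L) =
      ∑ σ : Equiv.Perm (Fin p), (Equiv.Perm.sign σ : ℤ) *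
        if ∀ j, j ≠ i → (G σ).edge j = L j then 1 else 0 := by
    rw [gapSum, map_sum]
    simp only [alternatingCoord_single]
    rw [Finset.sum_comm]
    refine Finset.sum_congr rfl fun σ _ => ?_
    rw [← Finset.mul_sum, Finset.sum_ite_eq']
    simp [G]
  have hneg : ∑ σ : Equiv.Perm (Fin p), (Equiv.Perm.sign σ : ℤ) *
        (if ∀ j, j ≠ i → (G σ).edge j = L j then 1 else 0) =
      -∑ σ : Equiv.Perm (Fin p), (Equiv.Perm.sign σ : ℤ) *
        if ∀ j, j ≠ i → (G σ).edge j = L j then 1 else 0 := by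
    rw [← Finset.sum_neg_distrib]
    rw [← Equiv.sum_comp (Equiv.mulRight (Equiv.swap a b))]
    refine Finset.sum_congr rfl fun σ _ => ?_
    have hG : ∀ j, j ≠ i → (G (σ * Equiv.swap a b)).edge j = (G σ).edge j := fun j hj =>
      hA.flagOfSeq_comp_swap_edge (fun j => T (σ j)) (hT.comp σ.injective) hab (hb ▸ hj)
    have hne : a ≠ b := fun h => by rw [h] at hab; omega
    have hiff : (∀ j, j ≠ i → (G (σ * Equiv.swap a b)).edge j = L j) ↔
        ∀ j, j ≠ i → (G σ).edge j = L j :=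
      forall₂_congr fun j hj => by rw [hG j hj]
    simp only [Equiv.coe_mulRight, hiff, Equiv.Perm.sign_mul, Equiv.Perm.sign_swap hne]
    split_ifs <;> simp
  rw [hsum]
  linarith

/-- The functional on the flag group induced by `alternatingCoord`. -/
noncomputable def flagGroupCoord (T : Fin p → A.hyperplanes)
    (hT : Function.Injective fun j => level (T j)) : A.FlagGroup p →ₗ[ℤ] ℤ :=
  (A.flagRelations p).liftQ (hA.alternatingCoord T hT) <| by
    rw [flagRelations, Submodule.span_le]
    rintro _ ⟨i, L, h₀, h₁, -, rfl⟩
    exact hA.alternatingCoord_gapSum T hT h₀ h₁ L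

/-- The classes of the flags of the sequences of hyperplanes with decreasing levels. -/
noncomputable def flagClass
    (T : {T : Fin p → A.hyperplanes // StrictAnti fun j => level (T j)}) : A.FlagGroup p :=
  (A.flagRelations p).mkQ (Finsupp.single (hA.flagOfSeq T.1 T.2.injective) 1)

open Classical in
-- Among the reorderings of a decreasing sequence only the identity is decreasing, so a single term
-- of the alternating sum can survive.
theorem flagGroupCoord_flagClass
    (T T' : {T : Fin p → A.hyperplanes // StrictAnti fun j => level (T j)}) :
    hA.flagGroupCoord T'.1 T'.2.injective (hA.flagClass T) = if T = T' then 1 else 0 := by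
  rw [flagGroupCoord, flagClass, Submodule.mkQ_apply, Submodule.liftQ_apply,
    alternatingCoord_single]
  simp only [hA.flagOfSeq_comp_perm_eq_iff T.2 T'.2, ← Subtype.ext_iff]
  rw [Finset.sum_eq_single 1]
  · simp
  · intro σ _ hσ
    simp [hσ]
  · simp

theorem linearIndependent_flagClass :
    LinearIndependent ℤ (hA.flagClass (p := p)) := by
  classical
  refine LinearIndependent.of_comp (LinearMap.pi fun
    T' : {T : Fin p → A.hyperplanes // StrictAnti fun j => level (T j)} =>
      hA.flagGroupCoord T'.1 T'.2.injective) ?_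
  have h : (⇑(LinearMap.pi fun
      T' : {T : Fin p → A.hyperplanes // StrictAnti fun j => level (T j)} =>
        hA.flagGroupCoord T'.1 T'.2.injective) ∘ hA.flagClass) = fun T => Pi.single T 1 := by
    funext T T'
    simp [flagGroupCoord_flagClass, Pi.single_apply, eq_comm]
  rw [h]
  exact Pi.linearIndependent_single_one
    {T : Fin p → A.hyperplanes // StrictAnti fun j => level (T j)} ℤ

/-! ### Labels of flags, and spanning by straightening -/

/-- As `a < b`, the pivots of `M` up to `a` are all pivots of `K'`. So `le_of_pivots` with cutoff
`a` puts `K'` inside every hyperplane of level `a` containing `K`. Thus only one edge between `L`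
and `M` adds the smaller pivot first, whereas several may add `b` first. -/
theorem eq_of_pivots_eq {L M K K' : AffineSubspace ℂ (Fin m → ℂ)} (hM : A.IsEdge M)
    (hK : A.IsEdge K) (hK' : A.IsEdge K') (hKL : K ≤ L) (hKL' : K' ≤ L) (hMK : M ≤ K)
    (hMK' : M ≤ K') {a b : Fin m} (hab : a < b)
    (hpK : pivots level K = insert a (pivots level L))
    (hpK' : pivots level K' = insert a (pivots level L))
    (hpM : pivots level M = insert b (insert a (pivots level L))) : K = K' := by
  have key : ∀ {K K' : AffineSubspace ℂ (Fin m → ℂ)}, A.IsEdge K → K ≤ L → K' ≤ L → M ≤ K →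
      M ≤ K' → pivots level K = insert a (pivots level L) →
      pivots level K' = insert a (pivots level L) → K' ≤ K := by
    intro K K' hK hKL hKL' hMK hMK' hpK hpK'
    refine hA.le_edge_of_pivots hK fun i hi => ?_
    rw [hpK, Finset.mem_insert] at hi
    rcases hi with rfl | hi
    · obtain ⟨H, hH, hKH⟩ := mem_pivots.1 (hpK ▸ Finset.mem_insert_self i _)
      refine ⟨H, hH, hKH, hA.le_of_pivots hM.1 i ?_ H hH.le (hMK.trans hKH)⟩
      intro j hj hjM
      rw [hpM, Finset.mem_insert, ← hpK'] at hjM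
      rcases hjM with rfl | hjM
      · exact absurd hab hj.not_gt
      · obtain ⟨H', hH', hKH'⟩ := mem_pivots.1 hjM
        exact ⟨H', hH', hMK'.trans hKH', hKH'⟩
    · obtain ⟨H, hH, hLH⟩ := mem_pivots.1 hi
      exact ⟨H, hH, hKL.trans hLH, hKL'.trans hLH⟩
  exact le_antisymm (key hK' hKL' hKL hMK' hMK hpK' hpK) (key hK hKL hKL' hMK hMK' hpK hpK')

theorem exists_label (F : A.Flag p) (k : Fin p) :
    ∃ i ∉ pivots level (F.edge k.castSucc),
      insert i (pivots level (F.edge k.castSucc)) = pivots level (F.edge k.succ) := by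
  rw [Finset.exists_eq_insert_iff]
  refine ⟨pivots_anti (F.antitone Fin.castSucc_lt_succ.le), ?_⟩
  rw [hA.card_pivots_edge, hA.card_pivots_edge]
  simp

/-- The pivot added at a step of a flag. -/
noncomputable def label (F : A.Flag p) (k : Fin p) : Fin m := (hA.exists_label F k).choose

theorem label_notMem (F : A.Flag p) (k : Fin p) :
    hA.label F k ∉ pivots level (F.edge k.castSucc) := (hA.exists_label F k).choose_spec.1

theorem insert_label (F : A.Flag p) (k : Fin p) :
    insert (hA.label F k) (pivots level (F.edge k.castSucc)) = pivots level (F.edge k.succ) :=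
  (hA.exists_label F k).choose_spec.2

theorem label_injective (F : A.Flag p) : Function.Injective (hA.label F) := by
  refine Function.Injective.of_lt_imp_ne fun j k hjk h => hA.label_notMem F k ?_
  rw [← h]
  refine pivots_anti (F.antitone (Fin.succ_le_castSucc_iff.2 hjk)) ?_
  rw [← hA.insert_label]
  exact Finset.mem_insert_self _ _

theorem exists_flagOfSeq_of_label {F : A.Flag p} (hF : StrictAnti (hA.label F)) :
    ∃ T : {T : Fin p → A.hyperplanes // StrictAnti fun j => level (T j)},
      F = hA.flagOfSeq T.1 T.2.injective := by
  have h : ∀ k, ∃ H, level H = hA.label F k ∧ F.edge k.succ ≤ H.1 := fun k =>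
    mem_pivots.1 (hA.insert_label F k ▸ Finset.mem_insert_self _ _)
  choose T hT hFT using h
  have hT' : StrictAnti fun j => level (T j) := by simpa only [hT] using hF
  exact ⟨⟨T, hT'⟩, hA.eq_flagOfSeq hT'.injective hFT⟩

end IsFibration
end Arrangement

namespace Arrangement

variable {m : ℕ} {A : Arrangement m}

namespace IsFibration

variable {level : A.hyperplanes → Fin m} (hA : A.IsFibration level) {p : ℕ}

/-- A weight of flags which decreases when an ascent of the labels is turned into a descent. -/
noncomputable def weight (level : A.hyperplanes → Fin m) (F : A.Flag p) : ℕ :=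
  ∑ k, ∑ i ∈ pivots level (F.edge k), (i.rev : ℕ)

include hA

/-- The gap is placed between the two steps of an ascent. Any other filling must add the larger
label first, by `eq_of_pivots_eq`; this changes one pivot of one edge from the smaller to the larger
label, and the reversed index in `weight` drops. -/
theorem exists_weight_lt {F : A.Flag p} (hF : ¬ StrictAnti (hA.label F)) :
    ∃ i : Fin (p + 1), 0 < i ∧ i < Fin.last p ∧ ∀ G : A.Flag p,
      (∀ j, j ≠ i → G.edge j = F.edge j) → G ≠ F → weight level G < weight level F := by
  obtain _ | p := p
  · exact absurd (fun a => a.elim0) hF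
  rw [Fin.strictAnti_iff_succ_lt] at hF
  push Not at hF
  obtain ⟨k, hk⟩ := hF
  have hlt : hA.label F k.castSucc < hA.label F k.succ :=
    hk.lt_of_ne ((hA.label_injective F).ne Fin.castSucc_lt_succ.ne)
  refine ⟨k.castSucc.succ, Fin.succ_pos _, ?_, fun G hG hne => ?_⟩
  · rw [Fin.lt_def]
    simp
  set i := k.castSucc.succ with hi
  set L := F.edge k.castSucc.castSucc
  set M := F.edge k.succ.succ
  have hiL : k.castSucc.castSucc < i := Fin.castSucc_lt_succ
  have hiM : i < k.succ.succ := Fin.succ_lt_succ_iff.2 Fin.castSucc_lt_succ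
  have hGL : G.edge k.castSucc.castSucc = L := hG _ hiL.ne
  have hGM : G.edge k.succ.succ = M := hG _ hiM.ne'
  have hpF : pivots level (F.edge i) = insert (hA.label F k.castSucc) (pivots level L) :=
    (hA.insert_label F k.castSucc).symm
  have hpM : pivots level M = insert (hA.label F k.succ)
      (insert (hA.label F k.castSucc) (pivots level L)) := by
    rw [← hpF, ← hA.insert_label F k.succ]
    rfl
  have haL : hA.label F k.castSucc ∉ pivots level L := hA.label_notMem F k.castSucc
  have hpG : insert (hA.label G k.castSucc) (pivots level L) = pivots level (G.edge i) := by
    have := hA.insert_label G k.castSucc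
    rwa [hGL] at this
  have hcL : hA.label G k.castSucc ∉ pivots level L := by
    have := hA.label_notMem G k.castSucc
    rwa [hGL] at this
  have hcM : hA.label G k.castSucc ∈ pivots level M :=
    pivots_anti (hGM ▸ G.antitone hiM.le : M ≤ G.edge i)
      (hpG ▸ Finset.mem_insert_self _ _)
  rw [hpM, Finset.mem_insert, Finset.mem_insert] at hcM
  -- The first new pivot of `G` is a pivot of `M`. It is not one of `L`, and taking the smaller
  -- label would force `G = F`.
  have hc : hA.label G k.castSucc = hA.label F k.succ := by
    rcases hcM with hc | hc | hc
    · exact hc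
    · refine absurd ?_ hne
      ext1
      funext j
      by_cases hj : j = i
      · rw [hj]
        refine hA.eq_of_pivots_eq (L := L) (M := M) (F.isEdge _) (G.isEdge i) (F.isEdge i)
          ?_ (F.antitone hiL.le) ?_ (F.antitone hiM.le) hlt ?_ hpF hpM
        · exact hGL ▸ G.antitone hiL.le
        · exact hGM ▸ G.antitone hiM.le
        · rw [← hpG, hc]
      · exact hG j hj
    · exact absurd hc hcL
  refine Finset.sum_lt_sum (fun j _ => ?_) ⟨i, Finset.mem_univ _, ?_⟩
  · by_cases hj : j = i
    · rw [hj, ← hpG, hpF, Finset.sum_insert hcL, Finset.sum_insert haL, hc]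
      have := Fin.lt_def.1 (Fin.rev_lt_rev.2 hlt)
      omega
    · rw [hG j hj]
  · rw [← hpG, hpF, Finset.sum_insert hcL, Finset.sum_insert haL, hc]
    have := Fin.lt_def.1 (Fin.rev_lt_rev.2 hlt)
    omega

/-- Strong induction on the weight: the relation at an ascent writes `F` as minus the sum of the
other fillings of the gap, all of smaller weight. -/
theorem mkQ_single_mem_span (F : A.Flag p) :
    (A.flagRelations p).mkQ (Finsupp.single F 1) ∈
      Submodule.span ℤ (Set.range (hA.flagClass (p := p))) := by
  classical
  induction hw : weight level F using Nat.strong_induction_on generalizing F with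
  | _ n ih =>
    subst hw
    by_cases hF : StrictAnti (hA.label F)
    · obtain ⟨T, hT⟩ := hA.exists_flagOfSeq_of_label hF
      refine Submodule.subset_span ⟨T, ?_⟩
      rw [flagClass, ← hT]
    obtain ⟨i, h₀, h₁, hi⟩ := hA.exists_weight_lt hF
    have hrel : (A.flagRelations p).mkQ (A.gapSum i F.edge) = 0 := by
      rw [Submodule.mkQ_apply, Submodule.Quotient.mk_eq_zero]
      exact Submodule.subset_span ⟨i, F.edge, h₀, h₁,
        ⟨fun j _ => F.isEdge j, fun j _ => F.codim_eq j, fun j l _ _ h => F.antitone h⟩, rfl⟩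
    rw [gapSum, ← Finset.add_sum_erase _ _ (a := F) (by simp), map_add] at hrel
    rw [eq_neg_of_add_eq_zero_left hrel, map_sum]
    refine neg_mem (sum_mem fun G hG => ?_)
    rw [Finset.mem_erase, Finset.mem_filter] at hG
    exact ih _ (hi G hG.2.2 hG.1) G rfl

theorem span_flagClass : Submodule.span ℤ (Set.range (hA.flagClass (p := p))) = ⊤ := by
  rw [eq_top_iff]
  rintro x -
  obtain ⟨y, rfl⟩ := (A.flagRelations p).mkQ_surjective x
  induction y using Finsupp.induction_linear with
  | zero => simp
  | add y z hy hz => rw [map_add]; exact add_mem hy hz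
  | single F n =>
    rw [← Finsupp.smul_single_one, map_smul]
    exact Submodule.smul_mem _ _ (hA.mkQ_single_mem_span F)

/-- The flags of the sequences of hyperplanes with decreasing levels form a basis. -/
noncomputable def flagBasis : Module.Basis
    {T : Fin p → A.hyperplanes // StrictAnti fun j => level (T j)} ℤ (A.FlagGroup p) :=
  Module.Basis.mk hA.linearIndependent_flagClass hA.span_flagClass.ge

theorem finrank_flagSpace : Module.finrank ℂ (A.FlagSpace p) =
    Nat.card {T : Fin p → A.hyperplanes // StrictAnti fun j => level (T j)} := by
  rw [Module.finrank_eq_nat_card_basis (hA.flagBasis.baseChange ℂ)]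

/-! ### Counting decreasing sequences -/

omit hA in
theorem natCard_strictAnti {X : Type*} [Finite X] (level : X → Fin m) (p : ℕ) :
    Nat.card {T : Fin p → X // StrictAnti fun j => level (T j)} =
      ∑ S ∈ Finset.powersetCard p Finset.univ, ∏ i ∈ S, Nat.card {x // level x = i} := by
  classical
  have : Fintype X := Fintype.ofFinite X
  let Y := Σ S : {S : Finset (Fin m) // S.card = p}, ∀ i : S.1, {x // level x = i}
  -- `orderIsoOfFin` enumerates increasingly and the sequences decrease, hence the `rev`.
  let e (S : {S : Finset (Fin m) // S.card = p}) (j : Fin p) : S.1 :=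
    S.1.orderIsoOfFin S.2 j.rev
  let f : Y → {T : Fin p → X // StrictAnti fun j => level (T j)} := fun y =>
    ⟨fun j => (y.2 (e y.1 j)).1, fun j k hjk => by
      simp only [(y.2 (e y.1 _)).2]
      exact (y.1.1.orderIsoOfFin y.1.2).strictMono (Fin.rev_lt_rev.2 hjk)⟩
  have he (S) : Function.Surjective (e S) :=
    (S.1.orderIsoOfFin S.2).surjective.comp Fin.rev_surjective
  have hf (y : Y) : y.1.1 = Finset.univ.image fun j => level ((f y).1 j) := by
    ext i
    simp only [Finset.mem_image, Finset.mem_univ, true_and, f, (y.2 _).2]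
    constructor
    · intro hi
      obtain ⟨j, hj⟩ := he y.1 ⟨i, hi⟩
      exact ⟨j, by rw [hj]⟩
    · rintro ⟨j, rfl⟩
      exact (e y.1 j).2
  have hbij : Function.Bijective f := by
    constructor
    · intro y y' h
      have hS : y.1 = y'.1 := Subtype.ext (by rw [hf y, hf y', h])
      obtain ⟨S, c⟩ := y
      obtain ⟨S', c'⟩ := y'
      obtain rfl : S = S' := hS
      refine congrArg (Sigma.mk S) (funext fun i => ?_)
      obtain ⟨j, rfl⟩ := he S i
      exact Subtype.ext (congrFun (congrArg Subtype.val h) j)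
    · rintro ⟨T, hT⟩
      let S : {S : Finset (Fin m) // S.card = p} :=
        ⟨Finset.univ.image fun j => level (T j), by
          rw [Finset.card_image_of_injective _ hT.injective, Finset.card_univ, Fintype.card_fin]⟩
      have hc (i : S.1) : ∃ j, level (T j) = i := by
        obtain ⟨j, -, hj⟩ := Finset.mem_image.1 i.2
        exact ⟨j, hj⟩
      choose c hc using hc
      have heT (j) : (e S j : Fin m) = level (T j) := by
        have := Finset.orderEmbOfFin_unique S.2 (f := fun j => level (T j.rev))
          (fun j => Finset.mem_image_of_mem _ (Finset.mem_univ _))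
          (fun j k hjk => hT (Fin.rev_lt_rev.2 hjk))
        have := congrFun this j.rev
        rw [Fin.rev_rev] at this
        exact this.symm
      refine ⟨⟨S, fun i => ⟨T (c i), hc i⟩⟩, Subtype.ext (funext fun j => ?_)⟩
      exact congrArg T (hT.injective ((hc (e S j)).trans (heT j)))
  rw [← Nat.card_eq_of_bijective f hbij, Nat.card_sigma]
  simp only [Nat.card_pi]
  rw [Finset.sum_subtype (p := fun S : Finset (Fin m) => S.card = p)
    (Finset.powersetCard p Finset.univ) (by simp)]
  exact Finset.sum_congr rfl fun S _ =>
    Finset.prod_coe_sort S.1 fun i => Nat.card {x // level x = i}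

theorem poincarePolynomial_eq : A.poincarePolynomial =
    ∏ i : Fin m, (1 + Polynomial.C (Nat.card {H // level H = i}) * Polynomial.X) := by
  have : Finite A.hyperplanes := A.finite
  rw [poincarePolynomial, Finset.prod_one_add, Finset.sum_powerset]
  simp only [Finset.card_univ, Fintype.card_fin]
  refine Finset.sum_congr rfl fun p _ => ?_
  rw [hA.finrank_flagSpace, natCard_strictAnti, map_sum, Finset.sum_mul]
  refine Finset.sum_congr rfl fun S hS => ?_
  rw [Finset.prod_mul_distrib, Finset.prod_const, (Finset.mem_powersetCard.1 hS).2, map_prod]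

end IsFibration
end Arrangement

/-! ### The cyclotomic arrangement as a fibration -/

/-- If `i < j`, translation along the `j`-th basis vector preserves an equation with pivot `i` but
not one with pivot `j`. -/
theorem HasPivot.unique {m : ℕ} {H : AffineSubspace ℂ (Fin m → ℂ)} {i j : Fin m}
    (hi : HasPivot H i) (hj : HasPivot H j) : i = j := by
  have key : ∀ {i j : Fin m}, HasPivot H i → HasPivot H j → ¬ i < j := by
    rintro i j ⟨f, c, rfl, hf, hf'⟩ ⟨g, d, h, hg, -⟩ hij
    have hmem : ∀ v, f v = c ↔ g v = d := fun v => by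
      rw [← mem_affineHyperplane, h, mem_affineHyperplane]
    set v : Fin m → ℂ := (c / f (Pi.single i 1)) • Pi.single i 1
    have hv : f v = c := by
      rw [map_smul, smul_eq_mul, div_mul_cancel₀ _ hf]
    have hw : f (v + Pi.single j 1) = c := by rw [map_add, hv, hf' j hij, add_zero]
    rw [hmem] at hv hw
    rw [map_add, hv, add_eq_left] at hw
    exact hg hw
  exact le_antisymm (not_lt.1 (key hj hi)) (not_lt.1 (key hi hj))

section Cyclotomic

variable {m N T : ℕ} (ω : ℂ) (z : Fin N → ℂ)

/-- Labels of the hyperplanes `t_i = s` of the cyclotomic arrangement, with `s` one of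
`ω^k t_j` (`j < i`), `0` and `ω^k z_j`. -/
abbrev SectionIndex (N T : ℕ) (i : Fin m) : Type :=
  (Fin i × Fin T) ⊕ Option (Fin N × Fin T)

/-- The points `0` and `ω^k z_j`. -/
def puncture : Option (Fin N × Fin T) → ℂ
  | none => 0
  | some (j, k) => ω ^ (k : ℕ) * z j

/-- The function `s` with a given label. -/
def sectionValue {i : Fin m} : SectionIndex N T i → (Fin m → ℂ) → ℂ
  | .inl (j, k), v => ω ^ (k : ℕ) * v (j.castLE i.2.le)
  | .inr o, _ => puncture ω z o

/-- The hyperplane `t_i = s`. -/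
noncomputable def sectionHyperplane (i : Fin m) :
    SectionIndex N T i → AffineSubspace ℂ (Fin m → ℂ)
  | .inl (j, k) => affineHyperplane
      (LinearMap.proj i - ω ^ (k : ℕ) • LinearMap.proj (j.castLE i.2.le)) 0
  | .inr o => hyperplaneC i (puncture ω z o)

theorem mem_sectionHyperplane {i : Fin m} (x : SectionIndex N T i) {v : Fin m → ℂ} :
    v ∈ sectionHyperplane ω z i x ↔ v i = sectionValue ω z x v := by
  rcases x with ⟨j, k⟩ | o
  · rw [sectionHyperplane, mem_affineHyperplane]
    simp [sectionValue, sub_eq_zero]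
  · rw [sectionHyperplane, hyperplaneC, mem_affineHyperplane]
    simp [sectionValue]

theorem hasPivot_sectionHyperplane (i : Fin m) (x : SectionIndex N T i) :
    HasPivot (sectionHyperplane ω z i x) i := by
  rcases x with ⟨j, k⟩ | o
  · have hj : Fin.castLE i.2.le j < i := by simp [Fin.lt_def]
    refine ⟨_, _, rfl, by simp [hj.ne], fun l hl => ?_⟩
    simp [hl.ne, (hj.trans hl).ne]
  · exact ⟨_, _, rfl, by simp, fun l hl => by simp [hl.ne]⟩

/-- A section does not involve the coordinate `i`, so resetting that coordinate of any point to the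
value of the section gives a point of the hyperplane. -/
theorem sectionHyperplane_eq_iff {i : Fin m} {x y : SectionIndex N T i} :
    sectionHyperplane ω z i x = sectionHyperplane ω z i y ↔
      ∀ v, sectionValue ω z x v = sectionValue ω z y v := by
  constructor
  · intro h v
    have hup : ∀ (x : SectionIndex N T i) c,
        sectionValue ω z x (Function.update v i c) = sectionValue ω z x v := by
      rintro (⟨j, k⟩ | o) c
      · have hj : Fin.castLE i.2.le j ≠ i := by simp [Fin.ext_iff, j.2.ne]
        simp [sectionValue, hj]
      · rfl
    have hmem : Function.update v i (sectionValue ω z x v) ∈ sectionHyperplane ω z i x := by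
      rw [mem_sectionHyperplane, hup, Function.update_self]
    rwa [h, mem_sectionHyperplane, hup, Function.update_self] at hmem
  · intro h
    ext v
    rw [mem_sectionHyperplane, mem_sectionHyperplane, h]

variable {ω z}

theorem IsPrimitiveRoot.exists_fin_pow_eq (hT : 1 ≤ T) (hω : IsPrimitiveRoot ω T) (n : ℕ) :
    ∃ k : Fin T, ω ^ (k : ℕ) = ω ^ n :=
  ⟨⟨n % T, Nat.mod_lt _ hT⟩, by
    conv_rhs => rw [← Nat.mod_add_div n T, pow_add, pow_mul, hω.pow_eq_one, one_pow, mul_one]⟩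

theorem IsPrimitiveRoot.exists_fin_eq_div (hT : 1 ≤ T) (hω : IsPrimitiveRoot ω T)
    (a b : Fin T) : ∃ k : Fin T, ∀ x y : ℂ,
      x = ω ^ (k : ℕ) * y ↔ ω ^ (a : ℕ) * x = ω ^ (b : ℕ) * y := by
  -- The exponent is `b - a` modulo `T`, kept non-negative by adding `T`.
  obtain ⟨k, hk⟩ := hω.exists_fin_pow_eq hT (b + (T - a))
  refine ⟨k, fun x y => ?_⟩
  have ha : ω ^ (a : ℕ) * ω ^ (k : ℕ) = ω ^ (b : ℕ) := by
    rw [hk, ← pow_add, show (a : ℕ) + (b + (T - a)) = b + T by omega, pow_add, hω.pow_eq_one,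
      mul_one]
  have h0 : ω ^ (a : ℕ) ≠ 0 := pow_ne_zero _ (hω.ne_zero (by omega))
  rw [← ha, mul_assoc, mul_right_inj' h0]

/-- Modularity, case by case. Equating multiples of t_j and t_j' for j < j' gives t_j' = ω^κ t_j;
distinct multiples of the same t_j agree where t_j = 0, which is why these hyperplanes are needed; a
multiple of t_j and a puncture give t_j = 0 or t_j = ω^κ z_n; distinct constants never agree. -/
theorem exists_sectionHyperplane_iff_eq (hT : 1 ≤ T) (hω : IsPrimitiveRoot ω T) {i : Fin m}
    {x y : SectionIndex N T i}
    (hne : sectionHyperplane ω z i x ≠ sectionHyperplane ω z i y)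
    (hmeet : ∃ v, sectionValue ω z x v = sectionValue ω z y v) :
    ∃ l < i, ∃ w : SectionIndex N T l, ∀ v,
      v ∈ sectionHyperplane ω z l w ↔ sectionValue ω z x v = sectionValue ω z y v := by
  have hlt (j : Fin i) : Fin.castLE i.2.le j < i := by simp [Fin.lt_def]
  have h0 (k : Fin T) : ω ^ (k : ℕ) ≠ 0 := pow_ne_zero _ (hω.ne_zero (by omega))
  have hmix : ∀ (j : Fin i) (k : Fin T) (o : Option (Fin N × Fin T)),
      ∃ l < i, ∃ w : SectionIndex N T l, ∀ v, v ∈ sectionHyperplane ω z l w ↔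
        sectionValue (i := i) ω z (.inl (j, k)) v = sectionValue (i := i) ω z (.inr o) v := by
    rintro j k (_ | ⟨n, k'⟩)
    · refine ⟨_, hlt j, .inr none, fun v => ?_⟩
      rw [mem_sectionHyperplane]
      simp [sectionValue, puncture, h0 k]
    · obtain ⟨κ, hκ⟩ := hω.exists_fin_eq_div hT k k'
      refine ⟨_, hlt j, .inr (some (n, κ)), fun v => ?_⟩
      rw [mem_sectionHyperplane]
      exact hκ _ _
  have hdiff : ∀ (j j' : Fin i) (k k' : Fin T), j < j' →
      ∃ l < i, ∃ w : SectionIndex N T l, ∀ v, v ∈ sectionHyperplane ω z l w ↔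
        sectionValue (i := i) ω z (.inl (j', k')) v =
          sectionValue (i := i) ω z (.inl (j, k)) v := by
    intro j j' k k' hj
    obtain ⟨κ, hκ⟩ := hω.exists_fin_eq_div hT k' k
    refine ⟨_, hlt j', .inl (⟨j, hj⟩, κ), fun v => ?_⟩
    rw [mem_sectionHyperplane]
    exact hκ _ _
  rcases x with ⟨j, k⟩ | o <;> rcases y with ⟨j', k'⟩ | o'
  · rcases lt_trichotomy j j' with hj | rfl | hj
    · simpa only [eq_comm] using hdiff j j' k k' hj
    · refine ⟨_, hlt j, .inr none, fun v => ?_⟩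
      have hk : ω ^ (k : ℕ) ≠ ω ^ (k' : ℕ) := fun h =>
        hne ((sectionHyperplane_eq_iff ω z).2 fun v => by simp [sectionValue, h])
      rw [mem_sectionHyperplane]
      simp [sectionValue, puncture, hk]
    · exact hdiff j' j k' k hj
  · exact hmix j k o'
  · simpa only [eq_comm] using hmix j' k' o
  · obtain ⟨v, hv⟩ := hmeet
    exact absurd ((sectionHyperplane_eq_iff ω z).2 fun _ => hv) hne

/-- The arrangement solves for the earlier of two coordinates and the sections for the later one, so
passing between them inverts the power of `ω`. -/
theorem mem_cyclotomicArrangement_iff (hT : 1 ≤ T) (hω : IsPrimitiveRoot ω T)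
    {H : AffineSubspace ℂ (Fin m → ℂ)} :
    H ∈ (cyclotomicArrangement m N T ω z).hyperplanes ↔
      ∃ (i : Fin m) (x : SectionIndex N T i), H = sectionHyperplane ω z i x := by
  have hswap : ∀ (k : Fin T), ∃ κ : Fin T, ∀ x y : ℂ,
      x = ω ^ (κ : ℕ) * y ↔ ω ^ (k : ℕ) * x = y := fun k => by
    obtain ⟨κ, hκ⟩ := hω.exists_fin_eq_div hT k ⟨0, hT⟩
    exact ⟨κ, fun x y => by rw [hκ]; simp⟩
  constructor
  · rintro ((⟨i, j, k, hij, rfl⟩ | ⟨i, j, k, rfl⟩) | ⟨i, rfl⟩)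
    · obtain ⟨κ, hκ⟩ := hswap k
      refine ⟨j, .inl (⟨i, hij⟩, κ), ?_⟩
      ext v
      rw [mem_sectionHyperplane, hyperplaneT, mem_affineHyperplane]
      refine Iff.trans ?_ (hκ _ _).symm
      simp [sub_eq_zero, eq_comm]
    · exact ⟨i, .inr (some (j, k)), rfl⟩
    · exact ⟨i, .inr none, rfl⟩
  · rintro ⟨i, ⟨j, k⟩ | _ | ⟨j, k⟩, rfl⟩
    · obtain ⟨κ, hκ⟩ := hswap k
      refine Or.inl (Or.inl ⟨Fin.castLE i.2.le j, i, κ, by simp [Fin.lt_def], ?_⟩)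
      ext v
      rw [mem_sectionHyperplane, hyperplaneT, mem_affineHyperplane]
      refine Iff.trans eq_comm (Iff.trans (hκ _ _).symm ?_)
      simp [sub_eq_zero]
    · exact Or.inr ⟨i, rfl⟩
    · exact Or.inl (Or.inr ⟨i, j, k, rfl⟩)

theorem puncture_injective (hω : IsPrimitiveRoot ω T) (hz : ∀ j, z j ≠ 0)
    (hdisj : Pairwise fun i j =>
      Disjoint {w : ℂ | ∃ k : Fin T, w = ω ^ (k : ℕ) * z i}
        {w : ℂ | ∃ k : Fin T, w = ω ^ (k : ℕ) * z j}) :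
    Function.Injective (puncture ω z : Option (Fin N × Fin T) → ℂ) := by
  have h0 (j) (k : Fin T) : ω ^ (k : ℕ) * z j ≠ 0 :=
    mul_ne_zero (pow_ne_zero _ (hω.ne_zero (k.pos.ne'))) (hz j)
  rintro (_ | ⟨j, k⟩) (_ | ⟨j', k'⟩) h
  · rfl
  · exact absurd h.symm (h0 _ _)
  · exact absurd h (h0 _ _)
  · simp only [puncture] at h
    obtain rfl : j = j' := by
      by_contra hj
      exact Set.disjoint_left.1 (hdisj hj) ⟨k, rfl⟩ ⟨k', h⟩
    rw [mul_left_inj' (hz j)] at h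
    rw [Fin.ext (hω.pow_inj k.2 k'.2 h)]

theorem sectionHyperplane_injective (hω : IsPrimitiveRoot ω T)
    (hp : Function.Injective (puncture ω z : Option (Fin N × Fin T) → ℂ)) (i : Fin m) :
    Function.Injective (sectionHyperplane (T := T) ω z i) := by
  have h0 (k : Fin T) : ω ^ (k : ℕ) ≠ 0 := pow_ne_zero _ (hω.ne_zero k.pos.ne')
  have hmix : ∀ (j : Fin i) (k : Fin T) (o : Option (Fin N × Fin T)),
      ¬ ∀ v, sectionValue (i := i) ω z (.inl (j, k)) v =
        sectionValue (i := i) ω z (.inr o) v := by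
    intro j k o h
    -- A non-zero linear section vanishes at `0` but not at the all-ones vector, while a constant
    -- takes the same value at both.
    have h₁ := h 0
    have h₂ := h 1
    simp only [sectionValue, Pi.zero_apply, Pi.one_apply, mul_zero, mul_one] at h₁ h₂
    exact h0 k (h₂.trans h₁.symm)
  rintro (⟨j, k⟩ | o) (⟨j', k'⟩ | o') h <;> rw [sectionHyperplane_eq_iff] at h
  · have h₁ := h (Pi.single (j.castLE i.2.le) 1)
    by_cases hj : j' = j
    · subst hj
      simp only [sectionValue, Pi.single_eq_same, mul_one] at h₁
      rw [Fin.ext (hω.pow_inj k.2 k'.2 h₁)]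
    · simp [sectionValue, hj, h0 k] at h₁
  · exact absurd h (hmix j k o')
  · exact absurd (fun v => (h v).symm) (hmix j' k' o)
  · rw [hp (h 0)]

theorem poincarePolynomial_cyclotomicArrangement (hT : 1 ≤ T) (hω : IsPrimitiveRoot ω T)
    (hp : Function.Injective (puncture ω z : Option (Fin N × Fin T) → ℂ)) :
    (cyclotomicArrangement m N T ω z).poincarePolynomial =
      ∏ i : Fin m, (1 + Polynomial.C (Fintype.card (SectionIndex N T i)) * Polynomial.X) := by
  set A := cyclotomicArrangement m N T ω z
  have hmem : ∀ H : A.hyperplanes, ∃ (i : Fin m) (x : SectionIndex N T i),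
      H.1 = sectionHyperplane ω z i x := fun H =>
    (mem_cyclotomicArrangement_iff hT hω).1 H.2
  choose level x hx using hmem
  have hpiv (H : A.hyperplanes) : HasPivot H.1 (level H) := by
    rw [hx H]
    exact hasPivot_sectionHyperplane ω z _ _
  -- `level` was obtained by choice; uniqueness of the pivot makes it independent of the chosen
  -- presentation.
  have hlevel {H : A.hyperplanes} {i : Fin m} {x : SectionIndex N T i}
      (h : H.1 = sectionHyperplane ω z i x) : level H = i :=
    (hpiv H).unique (h ▸ hasPivot_sectionHyperplane ω z i x)
  have hA : A.IsFibration level := by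
    refine ⟨hpiv, fun H K hHK hne v hvH hvK => ?_⟩
    obtain ⟨i, x, hH⟩ : ∃ i x, H.1 = sectionHyperplane ω z i x := ⟨_, _, hx H⟩
    obtain ⟨i', y, hK⟩ : ∃ i x, K.1 = sectionHyperplane ω z i x := ⟨_, _, hx K⟩
    obtain rfl : i = i' := by rw [← hlevel hH, ← hlevel hK, hHK]
    rw [hH, mem_sectionHyperplane] at hvH
    rw [hK, mem_sectionHyperplane] at hvK
    obtain ⟨l, hl, w, hw⟩ := exists_sectionHyperplane_iff_eq hT hω
      (fun h => hne (Subtype.ext (hH.trans (h.trans hK.symm)))) ⟨v, hvH.symm.trans hvK⟩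
    refine ⟨⟨sectionHyperplane ω z l w, (mem_cyclotomicArrangement_iff hT hω).2 ⟨l, w, rfl⟩⟩,
      ?_, ?_, ?_⟩
    · rw [hlevel rfl, hlevel hH]
      exact hl
    · rintro u ⟨huH, huK⟩
      rw [SetLike.mem_coe, hH, mem_sectionHyperplane] at huH
      rw [SetLike.mem_coe, hK, mem_sectionHyperplane] at huK
      exact (hw u).2 (huH.symm.trans huK)
    · rintro u ⟨huM, huH⟩
      rw [SetLike.mem_coe, hH, mem_sectionHyperplane] at huH
      rw [hK, mem_sectionHyperplane]
      exact huH.trans ((hw u).1 huM)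
  rw [hA.poincarePolynomial_eq]
  refine Finset.prod_congr rfl fun i _ => ?_
  let f : SectionIndex N T i → {H // level H = i} := fun x =>
    ⟨⟨sectionHyperplane ω z i x, (mem_cyclotomicArrangement_iff hT hω).2 ⟨i, x, rfl⟩⟩, hlevel rfl⟩
  have hf : Function.Bijective f := by
    constructor
    · intro x y h
      exact sectionHyperplane_injective hω hp i
        (congrArg (fun H : {H // level H = i} => H.1.1) h)
    · rintro ⟨H, rfl⟩
      exact ⟨x H, Subtype.ext (Subtype.ext (hx H).symm)⟩
  rw [← Nat.card_eq_of_bijective f hf, Nat.card_eq_fintype_card]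

end Cyclotomic

theorem mainTheorem5 (m N T : ℕ) (hT : 1 ≤ T) (ω : ℂ) (hω : IsPrimitiveRoot ω T)
    (z : Fin N → ℂ) (hz : ∀ j, z j ≠ 0)
    (hdisj : Pairwise fun i j =>
      Disjoint {w : ℂ | ∃ k : Fin T, w = ω ^ (k : ℕ) * z i}
        {w : ℂ | ∃ k : Fin T, w = ω ^ (k : ℕ) * z j}) :
    (cyclotomicArrangement m N T ω z).poincarePolynomial =
      ∏ p ∈ Finset.range m,
        (1 + Polynomial.C (1 + (p + N) * T) * Polynomial.X) := by
  rw [poincarePolynomial_cyclotomicArrangement hT hω (puncture_injective hω hz hdisj),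
    ← Fin.prod_univ_eq_prod_range (fun p => 1 + Polynomial.C (1 + (p + N) * T) * Polynomial.X)]
  refine Finset.prod_congr rfl fun i _ => ?_
  have : Fintype.card (SectionIndex N T i) = 1 + (i + N) * T := by
    simp only [Fintype.card_sum, Fintype.card_prod, Fintype.card_fin, Fintype.card_option]
    ring
  rw [this]
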